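/- Let $n\ge 0$ and let $p_1,\dots,p_n$ be propositional variables. An implicative meet-semilattice is a meet-semilattice with a largest element and a binary operation $\to$ such that $a\wedge b\le c \iff a\le b\to c$. Let $F_{\wedge,\to}(n)$ and $F_{HA}(n)$ be the free implicative meet-semilattice and the free Heyting algebra on $p_1,\dots,p_n$, i.e. the Lindenbaum algebras of the $(\wedge,\to)$-fragment (with $\top$) of intuitionistic propositional logic and of the full logic. For a poset $X$, let $\mathcal U(X)$ be the set of up-sets of $X$, with $U\wedge V=U\cap V$ and $U\to V=\{x : \text{for all } y\ge x,\ y\in U \text{ implies } y\in V\}$. A model is a poset $M$ with an order-preserving map $c\colon M\to\{0,1\}^n$; a point $x$ is separated if there is an $i$ with $c(x)_i=0$ and $c(y)_i=1$ for all $y>x$, and $M^s$ is the submodel of $M$ on its separated points (with the restricted order and colouring). A p-morphism $f\colon M\to N$ is an order-preserving map such that $c_N(f(x))=c_M(x)$ for all $x\in M$ and such that whenever $f(x)\le y$ there is $x'\ge x$ with $f(x')=y$. The $n$-universal model $U(n)$ is the set of those prime (proper) filters $x$ of $F_{HA}(n)$ for which only finitely many prime filters contain $x$, ordered by inclusion,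 with $c(x)_i=1$ iff $p_i\in x$. Then there is exactly one p-morphism $f\colon U(n)^s\to U(n)$. Its image, denoted $U(n)_{\wedge,\to}$, is a finite generated submodel (that is, a finite up-set) of $U(n)$; it consists exactly of those points $x\in U(n)$ such that every $y\ge x$ in $U(n)$ is separated; and $$F_{\wedge,\to}(n)\;\cong\;\mathcal U\bigl(U(n)_{\wedge,\to}\bigr)$$ as implicative meet-semilattices. -/

import Mathlib

/-! ## Implicative meet-semilattices -/

/-- An implicative meet-semilattice: a meet-semilattice with an operation `⇨` such that
`a ⊓ b ≤ c ↔ a ≤ b ⇨ c`.  The largest element exists automatically (it is `a ⇨ a`) and is recorded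
as data, which only excludes the empty algebra. -/
class ImpSemilattice (A : Type*) extends SemilatticeInf A, OrderTop A, HImp A where
  le_himp_iff : ∀ a b c : A, a ≤ b ⇨ c ↔ a ⊓ b ≤ c

/-- `(∧,→)`-homomorphisms. -/
def IsMeetImpHom {A B : Type*} [ImpSemilattice A] [ImpSemilattice B] (h : A → B) : Prop :=
  (∀ a b, h (a ⊓ b) = h a ⊓ h b) ∧ (∀ a b, h (a ⇨ b) = h a ⇨ h b)

theorem ImpSemilattice.himp_self {A : Type*} [ImpSemilattice A] (a : A) : a ⇨ a = ⊤ :=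
  top_le_iff.1 ((ImpSemilattice.le_himp_iff _ _ _).2 inf_le_right)

theorem IsMeetImpHom.map_top {A B : Type*} [ImpSemilattice A] [ImpSemilattice B] {h : A → B}
    (hh : IsMeetImpHom h) : h ⊤ = ⊤ := by
  rw [← ImpSemilattice.himp_self (⊤ : A), hh.2, ImpSemilattice.himp_self]

/-- The set of up-sets of a poset, ordered by inclusion. -/
def UpSet (X : Type*) [Preorder X] : Type _ := {s : Set X // IsUpperSet s}

namespace UpSet

variable {X : Type*} [Preorder X]

instance : PartialOrder (UpSet X) := inferInstanceAs (PartialOrder {s : Set X // IsUpperSet s})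

/-- Meet is intersection, and `x ∈ U ⇨ V` iff for all `y ≥ x`, `y ∈ U` implies `y ∈ V`. -/
instance : ImpSemilattice (UpSet X) where
  inf U V := ⟨U.1 ∩ V.1, U.2.inter V.2⟩
  inf_le_left _ _ := fun _ hx => hx.1
  inf_le_right _ _ := fun _ hx => hx.2
  le_inf _ _ _ h₁ h₂ := fun _ hx => ⟨h₁ hx, h₂ hx⟩
  top := ⟨Set.univ, isUpperSet_univ⟩
  le_top _ := fun _ _ => trivial
  himp U V := ⟨{x | ∀ y, x ≤ y → y ∈ U.1 → y ∈ V.1}, fun _ _ hab ha y hy => ha y (hab.trans hy)⟩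
  le_himp_iff U _ _ :=
    ⟨fun h x hx => h hx.1 x le_rfl hx.2, fun h _ hx _ hxy hy => h ⟨U.2 hxy hx, hy⟩⟩

end UpSet

/-! ## The free `n`-generated implicative meet-semilattice -/

/-- `(∧,→)`-formulas in the variables `p_0, …, p_{n-1}`.  The constant `⊤` is definable as soon
as there is a variable. -/
inductive MeetImpFormula (n : ℕ) : Type
  | var : Fin n → MeetImpFormula n
  | top : MeetImpFormula n
  | and : MeetImpFormula n → MeetImpFormula n → MeetImpFormula n
  | imp : MeetImpFormula n → MeetImpFormula n → MeetImpFormula n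

/-- Derivability of one `(∧,→)`-formula from another. -/
inductive MeetImpFormula.Entails {n : ℕ} : MeetImpFormula n → MeetImpFormula n → Prop
  | refl (φ) : Entails φ φ
  | trans {φ ψ χ} : Entails φ ψ → Entails ψ χ → Entails φ χ
  | le_top (φ) : Entails φ top
  | and_left (φ ψ) : Entails (and φ ψ) φ
  | and_right (φ ψ) : Entails (and φ ψ) ψ
  | le_and {φ ψ χ} : Entails φ ψ → Entails φ χ → Entails φ (and ψ χ)
  | imp_intro {φ ψ χ} : Entails (and φ ψ) χ → Entails φ (imp ψ χ)
  | imp_elim {φ ψ χ} : Entails φ (imp ψ χ) → Entails (and φ ψ) χ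

instance MeetImpFormula.instPreorder (n : ℕ) : Preorder (MeetImpFormula n) where
  le := Entails
  le_refl := .refl
  le_trans _ _ _ := .trans

/-- The free implicative meet-semilattice on `n` generators: `(∧,→)`-formulas modulo
interderivability. -/
def FreeMeetImp (n : ℕ) : Type := Antisymmetrization (MeetImpFormula n) (· ≤ ·)

namespace FreeMeetImp

open MeetImpFormula

variable {n : ℕ}

instance : PartialOrder (FreeMeetImp n) :=
  inferInstanceAs (PartialOrder (Antisymmetrization (MeetImpFormula n) (· ≤ ·)))

/-- The class of a formula. -/
def mk (φ : MeetImpFormula n) : FreeMeetImp n := toAntisymmetrization (· ≤ ·) φ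

theorem ind {C : FreeMeetImp n → Prop} (h : ∀ φ, C (mk φ)) (a : FreeMeetImp n) : C a :=
  Quotient.inductionOn' a h

theorem and_mono {φ φ' ψ ψ' : MeetImpFormula n} (h : φ ≤ φ') (k : ψ ≤ ψ') :
    φ.and ψ ≤ φ'.and ψ' :=
  Entails.le_and ((Entails.and_left _ _).trans h) ((Entails.and_right _ _).trans k)

theorem imp_mono {φ φ' ψ ψ' : MeetImpFormula n} (h : φ' ≤ φ) (k : ψ ≤ ψ') :
    φ.imp ψ ≤ φ'.imp ψ' :=
  Entails.imp_intro (((and_mono le_rfl h).trans (Entails.imp_elim (.refl _))).trans k)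

instance : ImpSemilattice (FreeMeetImp n) where
  inf := Quotient.map₂ and fun _ _ h _ _ k => ⟨and_mono h.1 k.1, and_mono h.2 k.2⟩
  inf_le_left := ind fun φ => ind fun ψ => Entails.and_left φ ψ
  inf_le_right := ind fun φ => ind fun ψ => Entails.and_right φ ψ
  le_inf := ind fun _ => ind fun _ => ind fun _ h k => Entails.le_and h k
  top := mk top
  le_top := ind fun φ => Entails.le_top φ
  himp := Quotient.map₂ imp fun _ _ h _ _ k => ⟨imp_mono h.2 k.1, imp_mono h.1 k.2⟩
  le_himp_iff := ind fun _ => ind fun _ => ind fun _ => ⟨Entails.imp_elim, Entails.imp_intro⟩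

/-- The universal property of `FreeMeetImp n`. -/
theorem existsUnique_lift {A : Type*} [ImpSemilattice A] (g : Fin n → A) :
    ∃! h : FreeMeetImp n → A, IsMeetImpHom h ∧ ∀ i, h (mk (var i)) = g i := by
  let ev : MeetImpFormula n → A := fun φ =>
    MeetImpFormula.rec g ⊤ (fun _ _ a b => a ⊓ b) (fun _ _ a b => a ⇨ b) φ
  have mono : ∀ φ ψ : MeetImpFormula n, φ ≤ ψ → ev φ ≤ ev ψ := by
    intro φ ψ h
    induction h with
    | refl => exact le_rfl
    | trans _ _ h k => exact h.trans k
    | le_top => exact le_top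
    | and_left => exact inf_le_left
    | and_right => exact inf_le_right
    | le_and _ _ h k => exact le_inf h k
    | imp_intro _ h => exact (ImpSemilattice.le_himp_iff _ _ _).2 h
    | imp_elim _ h => exact (ImpSemilattice.le_himp_iff _ _ _).1 h
  refine ⟨fun a => Quotient.liftOn' a ev fun φ ψ h => le_antisymm (mono _ _ h.1) (mono _ _ h.2),
    ⟨⟨ind fun φ => ind fun ψ => rfl, ind fun φ => ind fun ψ => rfl⟩, fun i => rfl⟩, ?_⟩
  rintro k ⟨hk, hv⟩
  funext a
  induction a using ind with
  | h φ =>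
    change k (mk φ) = ev φ
    induction φ with
    | var i => exact hv i
    | top => exact hk.map_top
    | and φ ψ h₁ h₂ => exact (hk.1 (mk φ) (mk ψ)).trans (congrArg₂ (· ⊓ ·) h₁ h₂)
    | imp φ ψ h₁ h₂ => exact (hk.2 (mk φ) (mk ψ)).trans (congrArg₂ (· ⇨ ·) h₁ h₂)

end FreeMeetImp

/-! ## The free `n`-generated Heyting algebra -/

/-- Formulas of intuitionistic propositional logic in the variables `p_0, …, p_{n-1}`. -/
inductive IPCFormula (n : ℕ) : Type
  | var : Fin n → IPCFormula n
  | bot : IPCFormula n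
  | top : IPCFormula n
  | and : IPCFormula n → IPCFormula n → IPCFormula n
  | or : IPCFormula n → IPCFormula n → IPCFormula n
  | imp : IPCFormula n → IPCFormula n → IPCFormula n

/-- Derivability of one formula from another in intuitionistic propositional logic. -/
inductive IPCFormula.Entails {n : ℕ} : IPCFormula n → IPCFormula n → Prop
  | refl (φ) : Entails φ φ
  | trans {φ ψ χ} : Entails φ ψ → Entails ψ χ → Entails φ χ
  | bot_le (φ) : Entails bot φ
  | le_top (φ) : Entails φ top
  | and_left (φ ψ) : Entails (and φ ψ) φ
  | and_right (φ ψ) : Entails (and φ ψ) ψ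
  | le_and {φ ψ χ} : Entails φ ψ → Entails φ χ → Entails φ (and ψ χ)
  | or_left (φ ψ) : Entails φ (or φ ψ)
  | or_right (φ ψ) : Entails ψ (or φ ψ)
  | or_le {φ ψ χ} : Entails φ χ → Entails ψ χ → Entails (or φ ψ) χ
  | imp_intro {φ ψ χ} : Entails (and φ ψ) χ → Entails φ (imp ψ χ)
  | imp_elim {φ ψ χ} : Entails φ (imp ψ χ) → Entails (and φ ψ) χ

instance IPCFormula.instPreorder (n : ℕ) : Preorder (IPCFormula n) where
  le := Entails
  le_refl := .refl
  le_trans _ _ _ := .trans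

/-- The free Heyting algebra on `n` generators, as the Lindenbaum algebra of intuitionistic
propositional logic. -/
def FreeHeyting (n : ℕ) : Type := Antisymmetrization (IPCFormula n) (· ≤ ·)

namespace FreeHeyting

open IPCFormula

variable {n : ℕ}

instance : PartialOrder (FreeHeyting n) :=
  inferInstanceAs (PartialOrder (Antisymmetrization (IPCFormula n) (· ≤ ·)))

/-- The class of a formula. -/
def mk (φ : IPCFormula n) : FreeHeyting n := toAntisymmetrization (· ≤ ·) φ

theorem ind {C : FreeHeyting n → Prop} (h : ∀ φ, C (mk φ)) (a : FreeHeyting n) : C a :=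
  Quotient.inductionOn' a h

theorem and_mono {φ φ' ψ ψ' : IPCFormula n} (h : φ ≤ φ') (k : ψ ≤ ψ') :
    φ.and ψ ≤ φ'.and ψ' :=
  Entails.le_and ((Entails.and_left _ _).trans h) ((Entails.and_right _ _).trans k)

theorem or_mono {φ φ' ψ ψ' : IPCFormula n} (h : φ ≤ φ') (k : ψ ≤ ψ') :
    φ.or ψ ≤ φ'.or ψ' :=
  Entails.or_le (h.trans (Entails.or_left _ _)) (k.trans (Entails.or_right _ _))

theorem imp_mono {φ φ' ψ ψ' : IPCFormula n} (h : φ' ≤ φ) (k : ψ ≤ ψ') :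
    φ.imp ψ ≤ φ'.imp ψ' :=
  Entails.imp_intro (((and_mono le_rfl h).trans (Entails.imp_elim (.refl _))).trans k)

instance : HeytingAlgebra (FreeHeyting n) where
  inf := Quotient.map₂ and fun _ _ h _ _ k => ⟨and_mono h.1 k.1, and_mono h.2 k.2⟩
  inf_le_left := ind fun φ => ind fun ψ => Entails.and_left φ ψ
  inf_le_right := ind fun φ => ind fun ψ => Entails.and_right φ ψ
  le_inf := ind fun _ => ind fun _ => ind fun _ h k => Entails.le_and h k
  sup := Quotient.map₂ or fun _ _ h _ _ k => ⟨or_mono h.1 k.1, or_mono h.2 k.2⟩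
  le_sup_left := ind fun φ => ind fun ψ => Entails.or_left φ ψ
  le_sup_right := ind fun φ => ind fun ψ => Entails.or_right φ ψ
  sup_le := ind fun _ => ind fun _ => ind fun _ h k => Entails.or_le h k
  top := mk top
  le_top := ind fun φ => Entails.le_top φ
  bot := mk bot
  bot_le := ind fun φ => Entails.bot_le φ
  himp := Quotient.map₂ imp fun _ _ h _ _ k => ⟨imp_mono h.2 k.1, imp_mono h.1 k.2⟩
  le_himp_iff := ind fun _ => ind fun _ => ind fun _ => ⟨Entails.imp_elim, Entails.imp_intro⟩
  compl := Quotient.map (fun φ => imp φ bot)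
    fun _ _ h => ⟨imp_mono h.2 le_rfl, imp_mono h.1 le_rfl⟩
  himp_bot := ind fun _ => rfl

/-- The universal property of `FreeHeyting n`. -/
theorem existsUnique_lift {H : Type*} [HeytingAlgebra H] (g : Fin n → H) :
    ∃! h : HeytingHom (FreeHeyting n) H, ∀ i, h (mk (var i)) = g i := by
  let ev : IPCFormula n → H := fun φ => IPCFormula.rec g ⊥ ⊤ (fun _ _ a b => a ⊓ b)
    (fun _ _ a b => a ⊔ b) (fun _ _ a b => a ⇨ b) φ
  have mono : ∀ φ ψ : IPCFormula n, φ ≤ ψ → ev φ ≤ ev ψ := by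
    intro φ ψ h
    induction h with
    | refl => exact le_rfl
    | trans _ _ h k => exact h.trans k
    | bot_le => exact bot_le
    | le_top => exact le_top
    | and_left => exact inf_le_left
    | and_right => exact inf_le_right
    | le_and _ _ h k => exact le_inf h k
    | or_left => exact le_sup_left
    | or_right => exact le_sup_right
    | or_le _ _ h k => exact sup_le h k
    | imp_intro _ h => exact le_himp_iff.2 h
    | imp_elim _ h => exact le_himp_iff.1 h
  refine ⟨{ toFun := fun a => Quotient.liftOn' a ev fun φ ψ h =>
              le_antisymm (mono _ _ h.1) (mono _ _ h.2)
            map_sup' := ind fun φ => ind fun ψ => rfl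
            map_inf' := ind fun φ => ind fun ψ => rfl
            map_bot' := rfl
            map_himp' := ind fun φ => ind fun ψ => rfl }, fun i => rfl, ?_⟩
  intro k hv
  ext a
  induction a using ind with
  | h φ =>
    change k (mk φ) = ev φ
    induction φ with
    | var i => exact hv i
    | bot => exact map_bot k
    | top => exact map_top k
    | and φ ψ h₁ h₂ => exact (map_inf k (mk φ) (mk ψ)).trans (congrArg₂ (· ⊓ ·) h₁ h₂)
    | or φ ψ h₁ h₂ => exact (map_sup k (mk φ) (mk ψ)).trans (congrArg₂ (· ⊔ ·) h₁ h₂)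
    | imp φ ψ h₁ h₂ => exact (map_himp k (mk φ) (mk ψ)).trans (congrArg₂ (· ⇨ ·) h₁ h₂)

end FreeHeyting

/-! ## Models -/

/-- A model on `n` variables: a poset with an order-preserving colouring into `2^n`. -/
structure KripkeModel (n : ℕ) where
  Point : Type
  [order : PartialOrder Point]
  colour : Point →o (Fin n → Prop)

namespace KripkeModel

variable {n : ℕ}

instance (M : KripkeModel n) : PartialOrder M.Point := M.order

/-- The submodel on a set of points, with the restricted order and colouring. -/
def submodel (M : KripkeModel n) (S : Set M.Point) : KripkeModel n where
  Point := S
  colour := ⟨fun x => M.colour x, fun _ _ h => M.colour.monotone h⟩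

/-- The set of points at which the variable `p_q` holds. -/
def val (M : KripkeModel n) (q : Fin n) : Set M.Point := {x | M.colour x q}

/-- `x` is a border point of `A`: it is a maximal element of the complement of `A`. -/
def IsBorderPoint (M : KripkeModel n) (A : Set M.Point) (x : M.Point) : Prop :=
  x ∉ A ∧ ∀ y, x < y → y ∈ A

/-- `x` is separated: it is a `q`-border point for some variable `q`. -/
def IsSeparated (M : KripkeModel n) (x : M.Point) : Prop :=
  ∃ q : Fin n, M.IsBorderPoint (M.val q) x

/-- The submodel `M^s` of separated points. -/
def separatedPart (M : KripkeModel n) : KripkeModel n := M.submodel {x | M.IsSeparated x}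

/-- p-morphisms between models. -/
def IsPMorphism (M N : KripkeModel n) (f : M.Point → N.Point) : Prop :=
  Monotone f ∧ (∀ x y, f x ≤ y → ∃ x', x ≤ x' ∧ f x' = y) ∧ ∀ x, N.colour (f x) = M.colour x

end KripkeModel

/-- The canonical model `C(n)`: prime filters of the free Heyting algebra ordered by inclusion, with
`p_i` true at `x` iff `p_i ∈ x`. -/
def canonicalModel (n : ℕ) : KripkeModel n where
  Point := {F : Order.PFilter (FreeHeyting n) // F.IsPrime}
  colour := ⟨fun x i => FreeHeyting.mk (.var i) ∈ x.1, fun x y h _ hi => (show x.1 ≤ y.1 from h) hi⟩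

/-- The universal model `U(n)`: the image-finite part of the canonical model. -/
def universalModel (n : ℕ) : KripkeModel n :=
  (canonicalModel n).submodel {x | (Set.Ici x).Finite}

/-!
Sending a point of an image-finite model `M` to the set of formulas that it forces is the only
p-morphism from `M` to `U(n)`. It is one because a prime filter above the theory of `x` that
differed from the finitely many theories above `x` would violate an implication from a finite
conjunction to a finite disjunction that holds at `x` (`exists_theory_eq`). It is the only one
because p-morphisms preserve forcing and, by the truth lemma, a point of `U(n)` is its own theory
(`IsPMorphism.eq_of_universalModel`).

Let `S` be the set of points of `U(n)` all of whose successors are separated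
(`hereditarilySeparated`). A p-morphism maps separated points to separated points, so the range of
`f : U(n)^s → U(n)` lies in `S`; and `f` is the identity on the generated submodel `S` by uniqueness.
Colours increase strictly along chains of separated points, and a point of `U(n)` is determined by
its colour and the points strictly above it, so `S` is finite (`finite_of_isSeparated`).

For the last claim, consider the canonical model `X` of the `(∧,→)`-fragment, whose points are the
filters of `F_{∧,→}(n)` that are maximal among those omitting some element (`meetImpModel`). If an
element of the fragment fails at a point and holds strictly above it, the same is true of some
variable (`isSeparated_of_isBorderPoint_extent`). Hence all points of `X` are separated, `X` is
finite by the argument above, and there is a p-morphism from `X` to `U(n)`, with values in `S`.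
So the fragment is complete for `S`, which is injectivity of the map from `F_{∧,→}(n)` to the
up-sets of `S` (`extent_injective`). Conversely `(∧,→)`-theories give a p-morphism from `S` to `X`
(`isPMorphism_meetImpTheory`). Its composite with the one from `X` to `S` is the identity by
uniqueness, so points of `S` are ordered as their `(∧,→)`-theories. This yields formulas defining
the complements of the principal down-sets of `S` (`exists_extent_eq_compl_Iic`), and every up-set
is a finite intersection of such complements (`extent_surjective`).
-/

/-! ### Filters in semilattices -/

namespace Order.PFilter

/-- The filter generated by a filter `F` and an element `a`. -/
def adjoin {A : Type*} [SemilatticeInf A] (F : PFilter A) (a : A) : PFilter A :=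
  IsPFilter.toPFilter (F := {c | ∃ f ∈ F, f ⊓ a ≤ c}) <| by
    refine .of_def ?_ ?_ ?_
    · obtain ⟨f, hf⟩ := F.nonempty
      exact ⟨f ⊓ a, f, hf, le_rfl⟩
    · rintro c ⟨f, hf, hc⟩ d ⟨g, hg, hd⟩
      exact ⟨c ⊓ d, ⟨f ⊓ g, inf_mem hf hg,
        le_inf ((inf_le_inf_right _ inf_le_left).trans hc)
          ((inf_le_inf_right _ inf_le_right).trans hd)⟩, inf_le_left, inf_le_right⟩
    · rintro c d hcd ⟨f, hf, hc⟩
      exact ⟨f, hf, hc.trans hcd⟩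

theorem mem_adjoin {A : Type*} [SemilatticeInf A] {F : PFilter A} {a c : A} :
    c ∈ F.adjoin a ↔ ∃ f ∈ F, f ⊓ a ≤ c := Iff.rfl

theorem le_adjoin {A : Type*} [SemilatticeInf A] (F : PFilter A) (a : A) : F ≤ F.adjoin a :=
  fun f hf => mem_adjoin.2 ⟨f, hf, inf_le_left⟩

theorem self_mem_adjoin {A : Type*} [SemilatticeInf A] (F : PFilter A) (a : A) :
    a ∈ F.adjoin a :=
  let ⟨f, hf⟩ := F.nonempty
  mem_adjoin.2 ⟨f, hf, inf_le_right⟩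

theorem finsetInf_mem_iff {A ι : Type*} [SemilatticeInf A] [OrderTop A] {F : PFilter A}
    {s : Finset ι} {a : ι → A} : s.inf a ∈ F ↔ ∀ i ∈ s, a i ∈ F := by
  classical
  induction s using Finset.induction_on with
  | empty => simp
  | insert i s _ ih => rw [Finset.inf_insert, inf_mem_iff, ih, Finset.forall_mem_insert]

/-- Prime filters of a lattice are the proper filters that contain one of `a`, `b` as soon as they
contain `a ⊔ b`. -/
theorem isPrime_iff_sup {A : Type*} [Lattice A] [OrderBot A] {F : PFilter A} :
    F.IsPrime ↔ ⊥ ∉ F ∧ ∀ a b, a ⊔ b ∈ F → a ∈ F ∨ b ∈ F := by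
  refine ⟨fun h => ⟨?_, fun a b hab => ?_⟩, fun h => ⟨?_⟩⟩
  · obtain ⟨a, ha⟩ := h.compl_ideal.Nonempty
    exact fun hb => ha (mem_of_le bot_le hb)
  · by_contra hc
    rw [not_or] at hc
    exact Ideal.sup_mem (s := h.compl_ideal.toIdeal) hc.1 hc.2 hab
  · refine ⟨fun a b hba ha hb => ha (mem_of_le hba hb), ⟨⊥, h.1⟩, fun a ha b hb => ?_⟩
    exact ⟨a ⊔ b, fun hab => (h.2 a b hab).elim ha hb, le_sup_left, le_sup_right⟩

theorem IsPrime.exists_mem_of_finsetSup_mem {A ι : Type*} [Lattice A] [OrderBot A]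
    {F : PFilter A} (hF : F.IsPrime) {s : Finset ι} {a : ι → A} (h : s.sup a ∈ F) :
    ∃ i ∈ s, a i ∈ F := by
  classical
  rw [isPrime_iff_sup] at hF
  induction s using Finset.induction_on with
  | empty => exact absurd h hF.1
  | insert i s _ ih =>
    rw [Finset.sup_insert] at h
    rcases hF.2 _ _ h with h | h
    · exact ⟨i, Finset.mem_insert_self _ _, h⟩
    · obtain ⟨j, hj, hj'⟩ := ih h
      exact ⟨j, Finset.mem_insert_of_mem hj, hj'⟩

/-- A filter of a Heyting algebra omitting `a ⇨ b` extends to a prime filter that contains `a` and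
omits `b`. -/
theorem exists_isPrime_of_himp_notMem {A : Type*} [HeytingAlgebra A] {F : PFilter A} {a b : A}
    (h : a ⇨ b ∉ F) : ∃ G : PFilter A, G.IsPrime ∧ F ≤ G ∧ a ∈ G ∧ b ∉ G := by
  have hdisj : Disjoint (F.adjoin a : Set A) (Ideal.principal b : Set A) := by
    refine Set.disjoint_left.2 fun c hc hcb => h ?_
    obtain ⟨f, hf, hfc⟩ := mem_adjoin.1 hc
    exact mem_of_le (le_himp_iff.2 (hfc.trans hcb)) hf
  obtain ⟨J, hJ, hbJ, hFJ⟩ := DistribLattice.prime_ideal_of_disjoint_filter_ideal hdisj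
  have hsub : F.adjoin a ≤ hJ.toPrimePair.F := fun c hc => Set.disjoint_left.1 hFJ hc
  exact ⟨hJ.toPrimePair.F, hJ.toPrimePair.F_isPrime, (le_adjoin F a).trans hsub,
    hsub (self_mem_adjoin F a), fun hb => hb (hbJ (Ideal.mem_principal.2 le_rfl))⟩

/-- `F` omits `b`, and every strictly larger filter contains `b`. -/
def IsMaximalOmitting {A : Type*} [Preorder A] (F : PFilter A) (b : A) : Prop :=
  b ∉ F ∧ ∀ G, F < G → b ∈ G

theorem exists_isMaximalOmitting {A : Type*} [Preorder A] {F : PFilter A} {b : A} (hb : b ∉ F) :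
    ∃ G, F ≤ G ∧ G.IsMaximalOmitting b := by
  obtain ⟨G, hFG, hG⟩ := zorn_le_nonempty₀ {G : PFilter A | b ∉ G} (fun c hc hchain K hK => by
    refine ⟨IsPFilter.toPFilter (F := ⋃ G ∈ c, (G : Set A)) (.of_def ?_ ?_ ?_), ?_, ?_⟩
    · obtain ⟨a, ha⟩ := K.nonempty
      exact ⟨a, Set.mem_biUnion hK ha⟩
    · intro x hx y hy
      simp only [Set.mem_iUnion] at hx hy
      obtain ⟨G, hG, hx⟩ := hx
      obtain ⟨H, hH, hy⟩ := hy
      -- two members of the chain lie in the larger of them, which is directed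
      obtain ⟨L, hL, hGL, hHL⟩ := hchain.directedOn G hG H hH
      obtain ⟨z, hz, hzx, hzy⟩ := L.directed x (hGL hx) y (hHL hy)
      exact ⟨z, Set.mem_biUnion hL hz, hzx, hzy⟩
    · intro x y hxy hx
      simp only [Set.mem_iUnion] at hx ⊢
      obtain ⟨G, hG, hx⟩ := hx
      exact ⟨G, hG, mem_of_le hxy hx⟩
    · intro hbU
      obtain ⟨G, hG, hbG⟩ := Set.mem_iUnion₂.1 (show b ∈ ⋃ G ∈ c, (G : Set A) from hbU)
      exact hc hG hbG
    · exact fun G hG a ha => Set.mem_biUnion hG ha) F hb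
  exact ⟨G, hFG, hG.prop, fun K hK => by_contra fun hbK => hK.not_ge (hG.le_of_ge hbK hK.le)⟩

/-- A filter of an implicative meet-semilattice omitting `a ⇨ b` extends to a filter that contains
`a` and is maximal among those omitting `b`. -/
theorem exists_isMaximalOmitting_of_himp_notMem {A : Type*} [ImpSemilattice A] {F : PFilter A}
    {a b : A} (h : a ⇨ b ∉ F) : ∃ G : PFilter A, F ≤ G ∧ a ∈ G ∧ G.IsMaximalOmitting b := by
  have hb : b ∉ F.adjoin a := fun hb => by
    obtain ⟨f, hf, hfb⟩ := mem_adjoin.1 hb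
    exact h (mem_of_le ((ImpSemilattice.le_himp_iff _ _ _).2 hfb) hf)
  obtain ⟨G, hG, hGb⟩ := exists_isMaximalOmitting hb
  exact ⟨G, (le_adjoin F a).trans hG, hG (self_mem_adjoin F a), hGb⟩

end Order.PFilter

theorem ImpSemilattice.mem_of_himp_mem {A : Type*} [ImpSemilattice A] {F : Order.PFilter A}
    {a b : A} (h : a ⇨ b ∈ F) (ha : a ∈ F) : b ∈ F :=
  Order.PFilter.mem_of_le ((ImpSemilattice.le_himp_iff _ _ _).1 le_rfl)
    (Order.PFilter.inf_mem h ha)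

/-! ### Forcing and p-morphisms -/

namespace KripkeModel

variable {n : ℕ}

/-- Intuitionistic Kripke forcing. -/
def Forces (M : KripkeModel n) : M.Point → IPCFormula n → Prop
  | x, .var i => M.colour x i
  | _, .bot => False
  | _, .top => True
  | x, .and φ ψ => M.Forces x φ ∧ M.Forces x ψ
  | x, .or φ ψ => M.Forces x φ ∨ M.Forces x ψ
  | x, .imp φ ψ => ∀ y, x ≤ y → M.Forces y φ → M.Forces y ψ

theorem Forces.mono {M : KripkeModel n} {x y : M.Point} (hxy : x ≤ y) {φ : IPCFormula n}
    (h : M.Forces x φ) : M.Forces y φ := by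
  induction φ with
  | var i => exact M.colour.monotone hxy i h
  | bot => exact h
  | top => trivial
  | and φ ψ ih₁ ih₂ => exact ⟨ih₁ h.1, ih₂ h.2⟩
  | or φ ψ ih₁ ih₂ => exact h.imp ih₁ ih₂
  | imp φ ψ => exact fun z hz => h z (hxy.trans hz)

theorem Forces.of_le {M : KripkeModel n} {φ ψ : IPCFormula n} (h : φ ≤ ψ) {x : M.Point}
    (hx : M.Forces x φ) : M.Forces x ψ := by
  induction h generalizing x with
  | refl => exact hx
  | trans _ _ h k => exact k (h hx)
  | bot_le => exact hx.elim
  | le_top => trivial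
  | and_left => exact hx.1
  | and_right => exact hx.2
  | le_and _ _ h k => exact ⟨h hx, k hx⟩
  | or_left => exact .inl hx
  | or_right => exact .inr hx
  | or_le _ _ h k => exact hx.elim h k
  | imp_intro _ h => exact fun y hy hyψ => h ⟨hx.mono hy, hyψ⟩
  | imp_elim _ h => exact h hx.1 _ le_rfl hx.2

/-- Forcing at `x` depends only on the colour of `x` and on the set of points above `x`. -/
theorem forces_congr {M : KripkeModel n} {x y : M.Point} (hc : M.colour x = M.colour y)
    (hI : Set.Ioi x = Set.Ioi y) (φ : IPCFormula n) : M.Forces x φ ↔ M.Forces y φ := by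
  have hlt : ∀ z, x < z ↔ y < z := fun z => Set.ext_iff.1 hI z
  induction φ with
  | var i => exact iff_of_eq (congrFun hc i)
  | bot => exact Iff.rfl
  | top => exact Iff.rfl
  | and φ ψ ih₁ ih₂ => exact and_congr ih₁ ih₂
  | or φ ψ ih₁ ih₂ => exact or_congr ih₁ ih₂
  | imp φ ψ ih₁ ih₂ =>
    constructor <;> intro h z hz hzφ <;> rcases hz.eq_or_lt with rfl | hz
    · exact ih₂.1 (h x le_rfl (ih₁.2 hzφ))
    · exact h z ((hlt z).2 hz).le hzφ
    · exact ih₂.2 (h y le_rfl (ih₁.1 hzφ))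
    · exact h z ((hlt z).1 hz).le hzφ

namespace IsPMorphism

variable {M N K : KripkeModel n} {f : M.Point → N.Point}

theorem comp {g : N.Point → K.Point} (hg : N.IsPMorphism K g) (hf : M.IsPMorphism N f) :
    M.IsPMorphism K (g ∘ f) := by
  refine ⟨hg.1.comp hf.1, fun x z hz => ?_, fun x => (hg.2.2 _).trans (hf.2.2 x)⟩
  obtain ⟨y, hy, rfl⟩ := hg.2.1 _ _ hz
  obtain ⟨x', hx', rfl⟩ := hf.2.1 _ _ hy
  exact ⟨x', hx', rfl⟩

theorem forces_iff (hf : M.IsPMorphism N f) (φ : IPCFormula n) (x : M.Point) :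
    N.Forces (f x) φ ↔ M.Forces x φ := by
  induction φ generalizing x with
  | var i => exact iff_of_eq (congrFun (hf.2.2 x) i)
  | bot => exact Iff.rfl
  | top => exact Iff.rfl
  | and φ ψ ih₁ ih₂ => exact and_congr (ih₁ x) (ih₂ x)
  | or φ ψ ih₁ ih₂ => exact or_congr (ih₁ x) (ih₂ x)
  | imp φ ψ ih₁ ih₂ =>
    constructor
    · exact fun h y hy hyφ => (ih₂ y).1 (h _ (hf.1 hy) ((ih₁ y).2 hyφ))
    · intro h z hz hzφ
      obtain ⟨y, hy, rfl⟩ := hf.2.1 _ _ hz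
      exact (ih₂ y).2 (h y hy ((ih₁ y).1 hzφ))

theorem isUpperSet_range (hf : M.IsPMorphism N f) : IsUpperSet (Set.range f) := by
  rintro _ y hy ⟨x, rfl⟩
  obtain ⟨x', -, rfl⟩ := hf.2.1 _ _ hy
  exact ⟨x', rfl⟩

theorem isSeparated (hf : M.IsPMorphism N f) {x : M.Point} (hx : M.IsSeparated x) :
    N.IsSeparated (f x) := by
  obtain ⟨q, hq, hq'⟩ := hx
  have hval : ∀ z, f z ∈ N.val q ↔ z ∈ M.val q := fun z => iff_of_eq (congrFun (hf.2.2 z) q)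
  refine ⟨q, fun h => hq ((hval x).1 h), fun y hy => ?_⟩
  obtain ⟨x', hx', rfl⟩ := hf.2.1 _ _ hy.le
  exact (hval x').2 (hq' x' (lt_of_le_of_ne hx' fun h => hy.ne (congrArg f h)))

end IsPMorphism

theorem isPMorphism_inclusion (M : KripkeModel n) {S T : Set M.Point} (hST : S ⊆ T)
    (hS : IsUpperSet S) : (M.submodel S).IsPMorphism (M.submodel T) (Set.inclusion hST) :=
  ⟨fun _ _ h => h, fun x y h => ⟨⟨y.1, hS h x.2⟩, h, rfl⟩, fun _ => rfl⟩

theorem isPMorphism_val (M : KripkeModel n) {S : Set M.Point} (hS : IsUpperSet S) :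
    (M.submodel S).IsPMorphism M Subtype.val :=
  ⟨fun _ _ h => h, fun x y h => ⟨⟨y, hS h x.2⟩, h, rfl⟩, fun _ => rfl⟩

theorem IsSeparated.submodel {M : KripkeModel n} {S : Set M.Point} {x : (M.submodel S).Point}
    (hx : M.IsSeparated x.1) : (M.submodel S).IsSeparated x := by
  obtain ⟨q, hq, hq'⟩ := hx
  exact ⟨q, hq, fun y hy => hq' y.1 hy⟩

theorem finite_Ici_submodel {M : KripkeModel n} {S : Set M.Point} {x : (M.submodel S).Point}
    (hx : (Set.Ici x.1).Finite) : (Set.Ici x).Finite :=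
  hx.preimage Subtype.val_injective.injOn

/-- If every point is separated, then colours increase strictly along the order. So if moreover
every point is determined by its colour and the points above it, then there are finitely many points
of each colour, by induction on the colour from the top. -/
theorem finite_of_isSeparated (M : KripkeModel n) (hsep : ∀ x, M.IsSeparated x)
    (hdet : ∀ x y, M.colour x = M.colour y → Set.Ioi x = Set.Ioi y → x = y) :
    Finite M.Point := by
  have hlt : ∀ x y, x < y → M.colour x < M.colour y := fun x y hxy => by
    obtain ⟨q, hq, hq'⟩ := hsep x
    exact (M.colour.monotone hxy.le).lt_of_not_ge fun h => hq (h q (hq' y hxy))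
  have hfin : ∀ c, {x | M.colour x = c}.Finite := fun c => by
    induction c using WellFoundedGT.induction with
    | ind c ih =>
      have hbig : {x | c < M.colour x}.Finite := by
        have : {x | c < M.colour x} = ⋃ d ∈ Set.Ioi c, {x | M.colour x = d} := by
          ext x
          simp
        rw [this]
        exact (Set.toFinite _).biUnion ih
      refine Set.Finite.of_finite_image (f := Set.Ioi) (hbig.finite_subsets.subset ?_)
        fun x hx y hy => hdet x y (hx.trans hy.symm)
      rintro _ ⟨x, hx, rfl⟩ y hy
      have hx : M.colour x = c := hx
      exact hx ▸ hlt x y hy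
  refine Set.finite_univ_iff.1 (((Set.toFinite Set.univ).biUnion fun c _ => hfin c).subset ?_)
  exact fun x _ => Set.mem_biUnion (Set.mem_univ (M.colour x)) rfl

/-! ### The universal model -/

/-- The filter of the elements of the free Heyting algebra that hold at `x`. -/
def theory (M : KripkeModel n) (x : M.Point) : Order.PFilter (FreeHeyting n) :=
  Order.IsPFilter.toPFilter
    (F := {a | Quotient.liftOn' a (M.Forces x) fun _ _ h => propext ⟨.of_le h.1, .of_le h.2⟩}) <| by
    refine .of_def ⟨FreeHeyting.mk .top, trivial⟩ ?_ ?_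
    · exact fun a ha b hb => ⟨a ⊓ b, by
        induction a using FreeHeyting.ind
        induction b using FreeHeyting.ind
        exact ⟨ha, hb⟩, inf_le_left, inf_le_right⟩
    · intro a b
      induction a using FreeHeyting.ind
      induction b using FreeHeyting.ind
      exact fun h ha => Forces.of_le h ha

variable {M N : KripkeModel n}

theorem himp_mem_theory {x : M.Point} {a b : FreeHeyting n} :
    a ⇨ b ∈ M.theory x ↔ ∀ y, x ≤ y → a ∈ M.theory y → b ∈ M.theory y := by
  induction a using FreeHeyting.ind
  induction b using FreeHeyting.ind
  exact Iff.rfl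

theorem theory_mono : Monotone M.theory := fun x y hxy a => by
  induction a using FreeHeyting.ind
  exact Forces.mono hxy

theorem isPrime_theory (x : M.Point) : (M.theory x).IsPrime := by
  refine Order.PFilter.isPrime_iff_sup.2 ⟨fun h => h, fun a b => ?_⟩
  induction a using FreeHeyting.ind
  induction b using FreeHeyting.ind
  exact fun h => h

/-- Above a point with finitely many points above it, every larger prime filter is realized. -/
theorem exists_theory_eq {x : M.Point} (hx : (Set.Ici x).Finite)
    {F : Order.PFilter (FreeHeyting n)} (hF : F.IsPrime) (hxF : M.theory x ≤ F) :
    ∃ y, x ≤ y ∧ M.theory y = F := by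
  by_contra! hne
  -- `a y` and `b y` witness that the theory of `y` differs from `F`
  have hwit : ∀ y, ∃ a b, x ≤ y → a ∈ F ∧ b ∉ F ∧ (a ∈ M.theory y → b ∈ M.theory y) := fun y => by
    by_cases hy : x ≤ y
    · by_cases hle : M.theory y ≤ F
      · obtain ⟨a, haF, hay⟩ := Set.not_subset.1 fun h => hne y hy (le_antisymm hle h)
        exact ⟨a, ⊥, fun _ => ⟨haF, (Order.PFilter.isPrime_iff_sup.1 hF).1, fun h => (hay h).elim⟩⟩
      · obtain ⟨b, hby, hbF⟩ := Set.not_subset.1 hle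
        exact ⟨⊤, b, fun _ => ⟨Order.PFilter.top_mem, hbF, fun _ => hby⟩⟩
    · exact ⟨⊤, ⊤, fun h => (hy h).elim⟩
  choose a b hab using hwit
  have hmem : ∀ y, y ∈ hx.toFinset ↔ x ≤ y := fun y => hx.mem_toFinset
  have himp : hx.toFinset.inf a ⇨ hx.toFinset.sup b ∈ F := hxF <| himp_mem_theory.2 fun y hy h =>
    Order.PFilter.mem_of_le (Finset.le_sup ((hmem y).2 hy))
      ((hab y hy).2.2 (Order.PFilter.finsetInf_mem_iff.1 h y ((hmem y).2 hy)))
  have hinf : hx.toFinset.inf a ∈ F :=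
    Order.PFilter.finsetInf_mem_iff.2 fun y hy => (hab y ((hmem y).1 hy)).1
  obtain ⟨y, hy, hby⟩ := hF.exists_mem_of_finsetSup_mem
    (Order.PFilter.mem_of_le himp_inf_le (Order.PFilter.inf_mem himp hinf))
  exact (hab y ((hmem y).1 hy)).2.1 hby

/-- The map from an image-finite model to the universal model, sending a point to its theory. -/
def toUniversal (M : KripkeModel n) (hM : ∀ x : M.Point, (Set.Ici x).Finite) (x : M.Point) :
    (universalModel n).Point :=
  ⟨⟨M.theory x, isPrime_theory x⟩, by
    refine Set.Finite.subset ((hM x).image fun y => ⟨M.theory y, isPrime_theory y⟩) ?_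
    intro F hF
    obtain ⟨y, hy, h⟩ := exists_theory_eq (hM x) F.2 hF
    exact ⟨y, hy, Subtype.ext h⟩⟩

theorem isPMorphism_toUniversal (hM : ∀ x : M.Point, (Set.Ici x).Finite) :
    M.IsPMorphism (universalModel n) (M.toUniversal hM) := by
  refine ⟨fun x y h => theory_mono h, fun x F hF => ?_, fun x => rfl⟩
  obtain ⟨y, hy, h⟩ := exists_theory_eq (hM x) F.1.2 hF
  exact ⟨y, hy, Subtype.ext (Subtype.ext h)⟩

/-- The truth lemma for the canonical model. -/
theorem forces_canonicalModel_iff {F : (canonicalModel n).Point} {φ : IPCFormula n} :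
    (canonicalModel n).Forces F φ ↔ FreeHeyting.mk φ ∈ F.1 := by
  induction φ generalizing F with
  | var i => exact Iff.rfl
  | bot => exact ⟨fun h => h.elim, (Order.PFilter.isPrime_iff_sup.1 F.2).1⟩
  | top => exact ⟨fun _ => Order.PFilter.top_mem, fun _ => trivial⟩
  | and φ ψ ih₁ ih₂ => exact (and_congr ih₁ ih₂).trans Order.PFilter.inf_mem_iff.symm
  | or φ ψ ih₁ ih₂ =>
    refine (or_congr ih₁ ih₂).trans
      ⟨?_, (Order.PFilter.isPrime_iff_sup.1 F.2).2 (FreeHeyting.mk φ) (FreeHeyting.mk ψ)⟩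
    rintro (h | h)
    · exact Order.PFilter.mem_of_le (le_sup_left (b := FreeHeyting.mk ψ)) h
    · exact Order.PFilter.mem_of_le (le_sup_right (a := FreeHeyting.mk φ)) h
  | imp φ ψ ih₁ ih₂ =>
    change _ ↔ FreeHeyting.mk φ ⇨ FreeHeyting.mk ψ ∈ F.1
    constructor
    · intro h
      by_contra hc
      obtain ⟨G, hG, hFG, hφ, hψ⟩ := Order.PFilter.exists_isPrime_of_himp_notMem hc
      exact hψ (ih₂.1 (h ⟨G, hG⟩ hFG (ih₁.2 hφ)))
    · exact fun h G hFG hφ => ih₂.2 <| Order.PFilter.mem_of_le himp_inf_le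
        (Order.PFilter.inf_mem (hFG h) (ih₁.1 hφ))

theorem forces_universalModel_iff {x : (universalModel n).Point} {φ : IPCFormula n} :
    (universalModel n).Forces x φ ↔ FreeHeyting.mk φ ∈ x.1.1 :=
  ((isPMorphism_val _ fun _ _ h hx => hx.subset (Set.Ici_subset_Ici.2 h)).forces_iff φ x).symm.trans
    forces_canonicalModel_iff

theorem eq_of_forces_universalModel_iff {x y : (universalModel n).Point}
    (h : ∀ φ, (universalModel n).Forces x φ ↔ (universalModel n).Forces y φ) : x = y := by
  refine Subtype.ext (Subtype.ext (Order.PFilter.ext _ _ (Set.ext fun a => ?_)))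
  induction a using FreeHeyting.ind with
  | h φ => exact forces_universalModel_iff.symm.trans ((h φ).trans forces_universalModel_iff)

theorem IsPMorphism.eq_of_universalModel {f g : M.Point → (universalModel n).Point}
    (hf : M.IsPMorphism (universalModel n) f) (hg : M.IsPMorphism (universalModel n) g) :
    f = g :=
  funext fun x => eq_of_forces_universalModel_iff fun φ =>
    (hf.forces_iff φ x).trans (hg.forces_iff φ x).symm

theorem finite_Ici_universalModel (x : (universalModel n).Point) : (Set.Ici x).Finite :=
  finite_Ici_submodel x.2

end KripkeModel

/-! ### Points all of whose successors are separated -/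

namespace KripkeModel

variable {n : ℕ}

theorem finite_Ici_separatedPart (x : (universalModel n).separatedPart.Point) :
    (Set.Ici x).Finite :=
  finite_Ici_submodel (finite_Ici_universalModel x.1)

/-- The points of the universal model all of whose successors are separated. -/
def hereditarilySeparated (n : ℕ) : Set (universalModel n).Point :=
  {x | ∀ y, x ≤ y → (universalModel n).IsSeparated y}

theorem isUpperSet_hereditarilySeparated : IsUpperSet (hereditarilySeparated n) :=
  fun _ _ hxy hx z hz => hx z (hxy.trans hz)

/-- The submodel of the universal model on the hereditarily separated points. -/
def hereditarilySeparatedModel (n : ℕ) : KripkeModel n :=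
  (universalModel n).submodel (hereditarilySeparated n)

theorem isPMorphism_hereditarilySeparatedModel_val :
    (hereditarilySeparatedModel n).IsPMorphism (universalModel n) Subtype.val :=
  isPMorphism_val _ isUpperSet_hereditarilySeparated

theorem IsPMorphism.mem_hereditarilySeparated {M : KripkeModel n}
    {f : M.Point → (universalModel n).Point} (hf : M.IsPMorphism (universalModel n) f)
    (hM : ∀ x, M.IsSeparated x) (x : M.Point) : f x ∈ hereditarilySeparated n := fun y hy => by
  obtain ⟨x', -, rfl⟩ := hf.2.1 _ _ hy
  exact hf.isSeparated (hM x')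

/-- The p-morphism from the separated part fixes every hereditarily separated point, because the
identity is the only p-morphism from a generated submodel of `U(n)` to `U(n)`. -/
theorem range_toUniversal_separatedPart :
    Set.range ((universalModel n).separatedPart.toUniversal finite_Ici_separatedPart) =
      hereditarilySeparated n := by
  have hf := isPMorphism_toUniversal (n := n) finite_Ici_separatedPart
  apply Set.Subset.antisymm
  · rintro _ ⟨x, rfl⟩
    exact hf.mem_hereditarilySeparated (fun z => z.2.submodel) x
  · have hsub : hereditarilySeparated n ⊆ {x | (universalModel n).IsSeparated x} :=
      fun x hx => hx x le_rfl
    have hι := isPMorphism_inclusion _ hsub isUpperSet_hereditarilySeparated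
    intro x hx
    exact ⟨_, congrFun ((hf.comp hι).eq_of_universalModel
      isPMorphism_hereditarilySeparatedModel_val) ⟨x, hx⟩⟩

theorem finite_hereditarilySeparatedModel : Finite (hereditarilySeparatedModel n).Point := by
  refine finite_of_isSeparated _ (fun x => (x.2 x.1 le_rfl).submodel) fun x y hc hI => ?_
  refine Subtype.ext (eq_of_forces_universalModel_iff fun φ => ?_)
  have h := isPMorphism_hereditarilySeparatedModel_val (n := n) |>.forces_iff φ
  exact (h x).trans ((forces_congr hc hI φ).trans (h y).symm)

end KripkeModel

/-! ### The model of maximal omitting filters -/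

/-- The inclusion of the `(∧,→)`-fragment into the full language. -/
def MeetImpFormula.toIPC {n : ℕ} : MeetImpFormula n → IPCFormula n
  | .var i => .var i
  | .top => .top
  | .and φ ψ => .and φ.toIPC ψ.toIPC
  | .imp φ ψ => .imp φ.toIPC ψ.toIPC

theorem MeetImpFormula.toIPC_mono {n : ℕ} {φ ψ : MeetImpFormula n} (h : φ ≤ ψ) :
    φ.toIPC ≤ ψ.toIPC := by
  induction h with
  | refl => exact .refl _
  | trans _ _ h k => exact .trans h k
  | le_top => exact .le_top _
  | and_left => exact .and_left _ _
  | and_right => exact .and_right _ _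
  | le_and _ _ h k => exact .le_and h k
  | imp_intro _ h => exact .imp_intro h
  | imp_elim _ h => exact .imp_elim h

namespace KripkeModel

variable {n : ℕ} {M N : KripkeModel n}

/-- The up-set of the points of `M` at which an element of the free implicative meet-semilattice
holds. -/
def extent (M : KripkeModel n) (a : FreeMeetImp n) : UpSet M.Point :=
  Quotient.liftOn' a (fun φ => ⟨{x | M.Forces x φ.toIPC}, fun _ _ h hx => hx.mono h⟩)
    fun _ _ h => Subtype.ext <| Set.ext fun _ =>
      ⟨.of_le (MeetImpFormula.toIPC_mono h.1), .of_le (MeetImpFormula.toIPC_mono h.2)⟩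

theorem isMeetImpHom_extent (M : KripkeModel n) : IsMeetImpHom M.extent :=
  ⟨FreeMeetImp.ind fun _ => FreeMeetImp.ind fun _ => rfl,
    FreeMeetImp.ind fun _ => FreeMeetImp.ind fun _ => rfl⟩

theorem mem_extent_inf {x : M.Point} {a b : FreeMeetImp n} :
    x ∈ (M.extent (a ⊓ b)).1 ↔ x ∈ (M.extent a).1 ∧ x ∈ (M.extent b).1 := by
  rw [M.isMeetImpHom_extent.1]
  exact Iff.rfl

theorem mem_extent_himp {x : M.Point} {a b : FreeMeetImp n} :
    x ∈ (M.extent (a ⇨ b)).1 ↔ ∀ y, x ≤ y → y ∈ (M.extent a).1 → y ∈ (M.extent b).1 := by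
  rw [M.isMeetImpHom_extent.2]
  exact Iff.rfl

theorem extent_mono : Monotone M.extent := fun a b h => by
  have := M.isMeetImpHom_extent.1 a b
  rw [inf_eq_left.2 h] at this
  exact inf_eq_left.1 this.symm

theorem IsPMorphism.mem_extent_iff {f : M.Point → N.Point} (hf : M.IsPMorphism N f)
    {x : M.Point} {a : FreeMeetImp n} : f x ∈ (N.extent a).1 ↔ x ∈ (M.extent a).1 := by
  induction a using FreeMeetImp.ind with
  | h φ => exact hf.forces_iff _ x

/-- If some element of the `(∧,→)`-fragment fails at `x` and holds at all points above, then so does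
a variable: a failing conjunction has a failing conjunct, and for an implication that fails at `x`
but at no point above, the conclusion fails at `x`. -/
theorem isSeparated_of_isBorderPoint_extent {x : M.Point} {a : FreeMeetImp n}
    (hx : M.IsBorderPoint (M.extent a).1 x) : M.IsSeparated x := by
  induction a using FreeMeetImp.ind with
  | h φ =>
    induction φ with
    | var i => exact ⟨i, hx⟩
    | top => exact (hx.1 trivial).elim
    | and φ ψ ih₁ ih₂ =>
      by_cases h : M.Forces x φ.toIPC
      · exact ih₂ ⟨fun h' => hx.1 ⟨h, h'⟩, fun y hy => (hx.2 y hy).2⟩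
      · exact ih₁ ⟨h, fun y hy => (hx.2 y hy).1⟩
    | imp φ ψ ih₁ ih₂ =>
      have hφ : M.Forces x φ.toIPC := by
        by_contra hc
        refine hx.1 fun y hxy hy => ?_
        rcases hxy.eq_or_lt with rfl | hlt
        · exact (hc hy).elim
        · exact hx.2 y hlt y le_rfl hy
      refine ih₂ ⟨fun hψ => hx.1 fun y hxy _ => hψ.mono hxy, fun y hy => ?_⟩
      exact hx.2 y hy y le_rfl (hφ.mono hy.le)

end KripkeModel

/-- The canonical model of the `(∧,→)`-fragment. Its points are the filters of the free implicative
meet-semilattice that are maximal among those omitting some element. -/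
def meetImpModel (n : ℕ) : KripkeModel n where
  Point := {F : Order.PFilter (FreeMeetImp n) // ∃ b, F.IsMaximalOmitting b}
  colour := ⟨fun F i => FreeMeetImp.mk (.var i) ∈ F.1,
    fun F G h _ hi => (show F.1 ≤ G.1 from h) hi⟩

namespace KripkeModel

variable {n : ℕ}

theorem mem_extent_meetImpModel_iff {F : (meetImpModel n).Point} {a : FreeMeetImp n} :
    F ∈ ((meetImpModel n).extent a).1 ↔ a ∈ F.1 := by
  induction a using FreeMeetImp.ind with
  | h φ =>
    induction φ generalizing F with
    | var i => exact Iff.rfl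
    | top => exact ⟨fun _ => Order.PFilter.top_mem, fun _ => trivial⟩
    | and φ ψ ih₁ ih₂ => exact (and_congr ih₁ ih₂).trans Order.PFilter.inf_mem_iff.symm
    | imp φ ψ ih₁ ih₂ =>
      change _ ↔ FreeMeetImp.mk φ ⇨ FreeMeetImp.mk ψ ∈ F.1
      constructor
      · intro h
        by_contra hc
        obtain ⟨G, hFG, hφ, hψ⟩ := Order.PFilter.exists_isMaximalOmitting_of_himp_notMem hc
        exact hψ.1 (ih₂.1 (h ⟨G, _, hψ⟩ hFG (ih₁.2 hφ)))
      · exact fun h G hFG hφ => ih₂.2 (ImpSemilattice.mem_of_himp_mem (hFG h) (ih₁.1 hφ))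

theorem isSeparated_meetImpModel (F : (meetImpModel n).Point) :
    (meetImpModel n).IsSeparated F := by
  obtain ⟨b, hb, hb'⟩ := F.2
  exact isSeparated_of_isBorderPoint_extent (a := b)
    ⟨fun h => hb (mem_extent_meetImpModel_iff.1 h),
      fun G hG => mem_extent_meetImpModel_iff.2 (hb' G.1 hG)⟩

theorem finite_meetImpModel : Finite (meetImpModel n).Point := by
  refine finite_of_isSeparated _ isSeparated_meetImpModel fun F G hc hI => ?_
  refine Subtype.ext (Order.PFilter.ext _ _ (Set.ext fun a => ?_))
  refine mem_extent_meetImpModel_iff.symm.trans (Iff.trans ?_ mem_extent_meetImpModel_iff)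
  induction a using FreeMeetImp.ind with
  | h φ => exact forces_congr hc hI _

theorem exists_isPMorphism_meetImpModel :
    ∃ g, (meetImpModel n).IsPMorphism (hereditarilySeparatedModel n) g := by
  have := finite_meetImpModel (n := n)
  have hg := isPMorphism_toUniversal (M := meetImpModel n) fun _ => Set.toFinite _
  have hmem := hg.mem_hereditarilySeparated isSeparated_meetImpModel
  refine ⟨fun F => ⟨_, hmem F⟩, fun F G h => hg.1 h, fun F y hy => ?_, hg.2.2⟩
  obtain ⟨G, hFG, hG⟩ := hg.2.1 F y.1 hy
  exact ⟨G, hFG, Subtype.ext hG⟩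

/-! ### Up-sets of hereditarily separated points -/

/-- Completeness of the `(∧,→)`-fragment with respect to the hereditarily separated points: a filter
containing `a` and maximal omitting `b` is a point of the canonical model of the fragment, which
maps to them. -/
theorem extent_injective : Function.Injective (hereditarilySeparatedModel n).extent := by
  have key : ∀ a b, (hereditarilySeparatedModel n).extent a =
      (hereditarilySeparatedModel n).extent b → a ≤ b := fun a b hab => by
    by_contra hle
    obtain ⟨G, haG, hG⟩ :=
      Order.PFilter.exists_isMaximalOmitting (F := Order.PFilter.principal a) (b := b) hle
    obtain ⟨g, hg⟩ := exists_isPMorphism_meetImpModel (n := n)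
    have ha : g ⟨G, b, hG⟩ ∈ ((hereditarilySeparatedModel n).extent a).1 :=
      hg.mem_extent_iff.2 (mem_extent_meetImpModel_iff.2 (Order.PFilter.principal_le_iff.1 haG))
    rw [hab] at ha
    exact hG.1 (mem_extent_meetImpModel_iff.1 (hg.mem_extent_iff.1 ha))
  exact fun a b hab => le_antisymm (key a b hab) (key b a hab.symm)

/-- The filter of the elements of the free implicative meet-semilattice that hold at `x`. -/
def meetImpTheory (M : KripkeModel n) (x : M.Point) : Order.PFilter (FreeMeetImp n) :=
  Order.IsPFilter.toPFilter (F := {a | x ∈ (M.extent a).1}) <| .of_def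
    ⟨FreeMeetImp.mk .top, trivial⟩
    (fun a ha b hb => ⟨a ⊓ b, mem_extent_inf.2 ⟨ha, hb⟩, inf_le_left, inf_le_right⟩)
    fun h ha => extent_mono h ha

variable {M : KripkeModel n}

theorem mem_meetImpTheory {x : M.Point} {a : FreeMeetImp n} :
    a ∈ M.meetImpTheory x ↔ x ∈ (M.extent a).1 := Iff.rfl

/-- Above a point with finitely many points above it, every larger filter that is maximal omitting
some element `b` is realized. -/
theorem exists_meetImpTheory_eq {x : M.Point} (hx : (Set.Ici x).Finite)
    {F : Order.PFilter (FreeMeetImp n)} {b : FreeMeetImp n} (hF : F.IsMaximalOmitting b)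
    (hxF : M.meetImpTheory x ≤ F) : ∃ y, x ≤ y ∧ M.meetImpTheory y = F := by
  by_contra! hne
  -- A theory not omitting an element of `F` properly contains `F`, hence contains `b`.
  have hwit : ∀ y, ∃ a ∈ F, x ≤ y → a ∈ M.meetImpTheory y → b ∈ M.meetImpTheory y := fun y => by
    by_cases hle : F ≤ M.meetImpTheory y
    · exact ⟨⊤, Order.PFilter.top_mem,
        fun hy _ => hF.2 _ (lt_of_le_of_ne hle fun h => hne y hy h.symm)⟩
    · obtain ⟨a, haF, hay⟩ := Set.not_subset.1 hle
      exact ⟨a, haF, fun _ h => (hay h).elim⟩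
  choose a haF hab using hwit
  have himp : hx.toFinset.inf a ⇨ b ∈ F := hxF <| mem_extent_himp.2 fun y hy h =>
    hab y hy (Order.PFilter.finsetInf_mem_iff.1 (mem_meetImpTheory.2 h) y (hx.mem_toFinset.2 hy))
  exact hF.1 (ImpSemilattice.mem_of_himp_mem himp
    (Order.PFilter.finsetInf_mem_iff.2 fun y _ => haF y))

/-- The theory of a `q`-border point `x` is maximal omitting `q`: a larger filter omitting `q`
extends to a maximal one, which is the theory of some `y > x`, where `q` holds. -/
theorem isMaximalOmitting_meetImpTheory {x : M.Point} (hx : (Set.Ici x).Finite) {q : Fin n}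
    (hq : M.IsBorderPoint (M.val q) x) :
    (M.meetImpTheory x).IsMaximalOmitting (FreeMeetImp.mk (.var q)) := by
  refine ⟨hq.1, fun G hG => ?_⟩
  by_contra hqG
  obtain ⟨H, hGH, hH⟩ := Order.PFilter.exists_isMaximalOmitting hqG
  obtain ⟨y, hy, rfl⟩ := exists_meetImpTheory_eq hx hH (hG.le.trans hGH)
  refine hH.1 (hq.2 y (lt_of_le_of_ne hy ?_))
  rintro rfl
  exact (hG.trans_le hGH).ne rfl

theorem isPMorphism_meetImpTheory (hM : ∀ x : M.Point, (Set.Ici x).Finite)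
    (hsep : ∀ x, M.IsSeparated x) : M.IsPMorphism (meetImpModel n) fun x =>
      ⟨M.meetImpTheory x, _, isMaximalOmitting_meetImpTheory (hM x) (hsep x).choose_spec⟩ := by
  refine ⟨fun x y h a ha => (M.extent a).2 h ha, fun x F hF => ?_, fun x => rfl⟩
  obtain ⟨b, hb⟩ := F.2
  obtain ⟨y, hy, h⟩ := exists_meetImpTheory_eq (hM x) hb hF
  exact ⟨y, hy, Subtype.ext h⟩

/-- The `(∧,→)`-fragment distinguishes the hereditarily separated points: composing
`meetImpTheory` with a p-morphism back gives the identity, by uniqueness of p-morphisms into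
`U(n)`. -/
theorem le_of_meetImpTheory_le {x y : (hereditarilySeparatedModel n).Point}
    (h : (hereditarilySeparatedModel n).meetImpTheory x ≤
      (hereditarilySeparatedModel n).meetImpTheory y) : x ≤ y := by
  have := finite_hereditarilySeparatedModel (n := n)
  obtain ⟨g, hg⟩ := exists_isPMorphism_meetImpModel (n := n)
  have hT := isPMorphism_meetImpTheory (M := hereditarilySeparatedModel n)
    (fun _ => Set.toFinite _) fun x => (x.2 x.1 le_rfl).submodel
  have hι := isPMorphism_hereditarilySeparatedModel_val (n := n)
  have hid := (hι.comp (hg.comp hT)).eq_of_universalModel hι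
  change x.1 ≤ y.1
  rw [← congrFun hid x, ← congrFun hid y]
  exact hι.1 (hg.1 h)

/-- For a `q`-border point `x`, the complement of the down-set of `x` is the extent of
`(⋀ z, (a z → q)) → q`, where `z` ranges over the points not below `x`, and `a z` holds at `z` but
not at `x`. Indeed `a z → q` holds at `x`, because `q` holds strictly above `x`. -/
theorem exists_extent_eq_compl_Iic (x : (hereditarilySeparatedModel n).Point) :
    ∃ a, ((hereditarilySeparatedModel n).extent a).1 = (Set.Iic x)ᶜ := by
  have := finite_hereditarilySeparatedModel (n := n)
  obtain ⟨q, hq, hq'⟩ : (hereditarilySeparatedModel n).IsSeparated x :=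
    (x.2 x.1 le_rfl).submodel
  have hwit : ∀ z : (hereditarilySeparatedModel n).Point, ∃ a, ¬ z ≤ x →
      z ∈ ((hereditarilySeparatedModel n).extent a).1 ∧
        x ∉ ((hereditarilySeparatedModel n).extent a).1 := fun z => by
    by_cases hz : z ≤ x
    · exact ⟨⊤, fun h => (h hz).elim⟩
    · obtain ⟨a, ha, ha'⟩ := Set.not_subset.1 fun h => hz (le_of_meetImpTheory_le h)
      exact ⟨a, fun _ => ⟨ha, ha'⟩⟩
  choose a ha using hwit
  let p : FreeMeetImp n := FreeMeetImp.mk (.var q)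
  let s := (Set.toFinite (Set.Iic x)ᶜ).toFinset
  have hinf : ∀ y, y ∈ ((hereditarilySeparatedModel n).extent (s.inf fun z => a z ⇨ p)).1 ↔
      ∀ z, ¬ z ≤ x → y ∈ ((hereditarilySeparatedModel n).extent (a z ⇨ p)).1 := fun y => by
    rw [← mem_meetImpTheory, Order.PFilter.finsetInf_mem_iff]
    simp [s, mem_meetImpTheory]
  refine ⟨(s.inf fun z => a z ⇨ p) ⇨ p, Set.ext fun z => ⟨fun hz hzx => ?_, fun hz => ?_⟩⟩
  · refine hq (mem_extent_himp.1 hz x hzx ((hinf x).2 fun w hw => ?_))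
    refine mem_extent_himp.2 fun y hxy hy => ?_
    rcases hxy.eq_or_lt with rfl | hlt
    · exact ((ha w hw).2 hy).elim
    · exact hq' y hlt
  · exact mem_extent_himp.2 fun y hzy hy =>
      mem_extent_himp.1 ((hinf y).1 hy z hz) y le_rfl
        (((hereditarilySeparatedModel n).extent (a z)).2 hzy (ha z hz).1)

theorem extent_surjective : Function.Surjective (hereditarilySeparatedModel n).extent := by
  intro U
  have := finite_hereditarilySeparatedModel (n := n)
  choose a ha using exists_extent_eq_compl_Iic (n := n)
  refine ⟨(Set.toFinite U.1ᶜ).toFinset.inf a, Subtype.ext (Set.ext fun y => ?_)⟩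
  rw [← mem_meetImpTheory, Order.PFilter.finsetInf_mem_iff]
  simp only [mem_meetImpTheory, ha, Set.Finite.mem_toFinset, Set.mem_compl_iff, Set.mem_Iic]
  exact ⟨fun h => by_contra fun hy => h y hy le_rfl, fun hy x hx hyx => hx (U.2 hyx hy)⟩

end KripkeModel

open KripkeModel

theorem corollary3p12 (n : ℕ) :
    ∃ f : (universalModel n).separatedPart.Point → (universalModel n).Point,
      -- `f` is the unique p-morphism from the submodel of separated points to the universal model;
      -- its image is the submodel of the universal model that is meant
      (universalModel n).separatedPart.IsPMorphism (universalModel n) f ∧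
      (∀ g, (universalModel n).separatedPart.IsPMorphism (universalModel n) g → g = f) ∧
      -- it is a finite generated submodel
      IsUpperSet (Set.range f) ∧
      (Set.range f).Finite ∧
      -- consisting of the points all of whose successors are separated
      Set.range f = {x | ∀ y, x ≤ y → (universalModel n).IsSeparated y} ∧
      -- and its algebra of up-sets is the free implicative meet-semilattice
      ∃ h : FreeMeetImp n → UpSet ((universalModel n).submodel (Set.range f)).Point,
        IsMeetImpHom h ∧ Function.Bijective h := by
  have hf := isPMorphism_toUniversal (n := n) finite_Ici_separatedPart
  refine ⟨_, hf, fun g hg => hg.eq_of_universalModel hf, hf.isUpperSet_range, ?_,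
    range_toUniversal_separatedPart, ?_⟩ <;> rw [range_toUniversal_separatedPart]
  · exact Set.finite_coe_iff.1 finite_hereditarilySeparatedModel
  · exact ⟨_, isMeetImpHom_extent (hereditarilySeparatedModel n), extent_injective,
      extent_surjective⟩
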